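/- Let $\mathbf{k}$ be a commutative ring. Let $\operatorname{QSym}$ be the Hopf algebra of quasisymmetric functions over $\mathbf{k}$, i.e., of the power series of bounded degree in commuting variables $x_1,x_2,x_3,\ldots$ over $\mathbf{k}$ in which, for all positive integers $a_1,\ldots,a_\ell$, the coefficients of $x_{i_1}^{a_1}\cdots x_{i_\ell}^{a_\ell}$ for all $i_1<\cdots<i_\ell$ are equal. Its product is that of power series, its counit is the constant term, and its coproduct is the $\mathbf{k}$-linear map with $\Delta(M_\alpha)=\sum_{\alpha=\beta\gamma}M_\beta\otimes M_\gamma$ (the sum is over all pairs of compositions $\beta,\gamma$ whose concatenation is $\alpha$), where $M_\alpha=\sum_{i_1<\cdots<i_\ell}x_{i_1}^{\alpha_1}\cdots x_{i_\ell}^{\alpha_\ell}$ for each composition $\alpha=(\alpha_1,\ldots,\alpha_\ell)$, that is, each finite (possibly empty) list of positive integers; these $M_\alpha$ form a basis of $\operatorname{QSym}$. Let $S$ be the antipode of $\operatorname{QSym}$. For a composition $\alpha=(\alpha_1,\ldots,\alpha_\ell)$, set $\ell(\alpha)=\ell$, $|\alpha|=\alpha_1+\cdots+\alpha_\ell$,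 $\operatorname{rev}\alpha=(\alpha_\ell,\ldots,\alpha_1)$ and $D(\alpha)=\{\alpha_1+\cdots+\alpha_i \mid 1\le i\le \ell-1\}$. For each $q\in\mathbf{k}$, set $$\eta_\alpha^{(q)}=\sum_{\substack{|\beta|=|\alpha|,\\ D(\beta)\subseteq D(\alpha)}}(q+1)^{\ell(\beta)}M_\beta ,$$ where the sum is over compositions $\beta$. **Theorem.** Let $p,q\in\mathbf{k}$ satisfy $pq=1$. Then, for every composition $\alpha$, $$S\left(\eta_\alpha^{(q)}\right)=(-q)^{\ell(\alpha)}\,\eta_{\operatorname{rev}\alpha}^{(p)} .$$ -/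

import Mathlib

namespace QSymFn

open scoped TensorProduct

/-- A composition: a finite list of positive integers.  Its length is `List.length`,
concatenation is `++`, and the reversal is `List.reverse`. -/
abbrev Comp : Type := List ℕ+

/-- The size `|α|` of a composition: the sum of its entries. -/
def Comp.size (α : Comp) : ℕ := (α.map (fun a : ℕ+ => (a : ℕ))).sum

/-- The partial sum map `D(α) = {α₁ + ⋯ + αᵢ | 1 ≤ i ≤ ℓ(α) - 1}`. -/
def Comp.D (α : Comp) : Finset ℕ :=
  (Finset.Ico 1 α.length).image (fun i => Comp.size (α.take i))

theorem Comp.finite_size_eq (n : ℕ) : {α : Comp | Comp.size α = n}.Finite := by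
  refine Set.Finite.of_finite_image (f := fun α : Comp => α.map (fun a : ℕ+ => (a : ℕ))) ?_ ?_
  · refine (Set.finite_range (fun c : Composition n => c.blocks)).subset ?_
    rintro _ ⟨α, hα, rfl⟩
    refine ⟨⟨α.map (fun a : ℕ+ => (a : ℕ)), ?_, hα⟩, rfl⟩
    intro i hi
    obtain ⟨a, _, rfl⟩ := List.mem_map.1 hi
    exact a.pos
  · exact (List.map_injective_iff.2 PNat.coe_injective).injOn

/-- The finite set `Comp_n` of all compositions of size `n`. -/
noncomputable def Comp.ofSize (n : ℕ) : Finset Comp := (Comp.finite_size_eq n).toFinset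

theorem Comp.mem_ofSize {n : ℕ} {α : Comp} : α ∈ Comp.ofSize n ↔ Comp.size α = n := by
  simp [Comp.ofSize]

/-- The monomial `x_{i₁}^{a₁} ⋯ x_{i_ℓ}^{a_ℓ}`, as an exponent vector. The countably many variables
are indexed by `ℕ`. -/
noncomputable def mono {ℓ : ℕ} (i a : Fin ℓ → ℕ) : ℕ →₀ ℕ :=
  ∑ t, Finsupp.single (i t) (a t)

/-- Pack-equivalence of monomials: the same sequence of nonzero exponents. -/
def PackEquiv (m n : ℕ →₀ ℕ) : Prop :=
  ∃ (ℓ : ℕ) (a : Fin ℓ → ℕ+) (i j : Fin ℓ → ℕ), StrictMono i ∧ StrictMono j ∧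
    m = mono i (fun t => (a t : ℕ)) ∧ n = mono j (fun t => (a t : ℕ))

/-- The monomial `x₁^{α₁} x₂^{α₂} ⋯ x_ℓ^{α_ℓ}` (in the first `ℓ = ℓ(α)` variables). -/
noncomputable def mon (α : Comp) : ℕ →₀ ℕ :=
  mono (fun t : Fin α.length => (t : ℕ)) (fun t => (α.get t : ℕ))

/-! Auxiliary facts on pack-equivalence. -/

theorem mono_apply {ℓ : ℕ} {i : Fin ℓ → ℕ} (hi : Function.Injective i) (a : Fin ℓ → ℕ)
    (t : Fin ℓ) : mono i a (i t) = a t := by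
  classical
  simp [mono, Finsupp.finsetSum_apply, Finsupp.single_apply, hi.eq_iff]

theorem mono_apply_of_notMem {ℓ : ℕ} {i : Fin ℓ → ℕ} (a : Fin ℓ → ℕ)
    {x : ℕ} (hx : ∀ t, i t ≠ x) : mono i a x = 0 := by
  classical
  simp [mono, Finsupp.finsetSum_apply, hx]

/-- The sequence of nonzero exponents of a monomial. -/
noncomputable def word (m : ℕ →₀ ℕ) : Comp :=
  (m.support.sort (· ≤ ·)).attach.map
    (fun x => Nat.toPNat (m x.1) (Nat.pos_of_ne_zero
      (Finsupp.mem_support_iff.1 ((Finset.mem_sort (· ≤ ·)).1 x.2))))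

theorem word_length (m : ℕ →₀ ℕ) : (word m).length = m.support.card := by
  rw [word, List.length_map, List.length_attach, Finset.length_sort]

theorem word_eq_nil (m : ℕ →₀ ℕ) : word m = [] ↔ m = 0 := by
  rw [← List.length_eq_zero_iff, word_length, Finset.card_eq_zero, Finsupp.support_eq_empty]

theorem word_map (m : ℕ →₀ ℕ) :
    (word m).map (fun a : ℕ+ => (a : ℕ)) = (m.support.sort (· ≤ ·)).map m := by
  rw [word, List.map_map]
  conv_rhs => rw [← List.attach_map_subtype_val (m.support.sort (· ≤ ·)), List.map_map]
  rfl

theorem coe_list_inj {α β : Comp}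
    (h : α.map (fun a : ℕ+ => (a : ℕ)) = β.map (fun a : ℕ+ => (a : ℕ))) : α = β :=
  List.map_injective_iff.2 PNat.coe_injective h

theorem word_mono {ℓ : ℕ} {i : Fin ℓ → ℕ} (hi : StrictMono i) (b : Fin ℓ → ℕ) :
    (word (mono i b)).map (fun a : ℕ+ => (a : ℕ)) = (List.ofFn b).filter (fun x => x ≠ 0) := by
  have hsort : (mono i b).support.sort (· ≤ ·) =
      (List.ofFn i).filter (fun x => mono i b x ≠ 0) := by
    have hs : ((List.ofFn i).filter (fun x => mono i b x ≠ 0)).Pairwise (· < ·) :=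
      (List.pairwise_ofFn.2 fun _ _ h => hi h).filter _
    refine List.Perm.eq_of_pairwise' (r := (· ≤ ·)) (Finset.pairwise_sort _ _)
      (hs.imp le_of_lt) ?_
    refine (List.perm_ext_iff_of_nodup (Finset.sort_nodup _ _)
      (hs.imp ne_of_lt)).2 fun x => ?_
    simp only [Finset.mem_sort, Finsupp.mem_support_iff, List.mem_filter, List.mem_ofFn,
      decide_eq_true_eq]
    refine ⟨fun h => ⟨?_, h⟩, fun h => h.2⟩
    by_contra hx
    exact h (mono_apply_of_notMem b fun t ht => hx ⟨t, ht⟩)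
  rw [word_map, hsort]
  have : List.ofFn b = (List.ofFn i).map (mono i b) := by
    rw [List.map_ofFn]
    congr 1
    ext t
    exact (mono_apply hi.injective b t).symm
  rw [this, List.filter_map]
  rfl

theorem word_mono_pos {ℓ : ℕ} {i : Fin ℓ → ℕ} (hi : StrictMono i) (a : Fin ℓ → ℕ+) :
    word (mono i (fun t => (a t : ℕ))) = List.ofFn a := by
  apply coe_list_inj
  rw [word_mono hi, List.filter_eq_self.2, List.map_ofFn]
  · rfl
  · intro x hx
    obtain ⟨t, rfl⟩ := List.mem_ofFn.1 hx
    simp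

theorem word_mon (α : Comp) : word (mon α) = α := by
  rw [mon, word_mono_pos Fin.val_strictMono, List.ofFn_get]

theorem eq_mono_word (m : ℕ →₀ ℕ) : ∃ i : Fin (word m).length → ℕ, StrictMono i ∧
    m = mono i (fun t => ((word m).get t : ℕ)) := by
  have hl : (word m).length = m.support.card := word_length m
  refine ⟨fun t => m.support.orderEmbOfFin hl.symm t, fun _ _ h => by simpa using h, ?_⟩
  ext x
  have hval : ∀ t, ((word m).get t : ℕ) = m (m.support.orderEmbOfFin hl.symm t) := by
    intro t
    rw [Finset.orderEmbOfFin_apply]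
    have h := List.getElem_of_eq (word_map m) (i := t) (by simp)
    rw [List.getElem_map, List.getElem_map] at h
    exact h
  by_cases hx : x ∈ m.support
  · have : x ∈ Set.range (m.support.orderEmbOfFin hl.symm) := by
      rw [Finset.range_orderEmbOfFin]; exact hx
    obtain ⟨t, rfl⟩ := this
    rw [mono_apply (i := fun t => m.support.orderEmbOfFin hl.symm t)
      (m.support.orderEmbOfFin hl.symm).injective, hval]
  · rw [mono_apply_of_notMem, Finsupp.notMem_support_iff.1 hx]
    rintro t rfl
    exact hx (Finset.orderEmbOfFin_mem _ _ _)

theorem packEquiv_iff {m n : ℕ →₀ ℕ} : PackEquiv m n ↔ word m = word n := by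
  constructor
  · rintro ⟨ℓ, a, i, j, hi, hj, rfl, rfl⟩
    rw [word_mono_pos hi, word_mono_pos hj]
  · intro h
    obtain ⟨i, hi, hm⟩ := eq_mono_word m
    obtain ⟨j, hj, hn⟩ := eq_mono_word n
    revert j hn
    rw [← h]
    intro j hj hn
    exact ⟨_, _, i, j, hi, hj, hm, hn⟩

theorem degree_eq_size (m : ℕ →₀ ℕ) : m.degree = Comp.size (word m) := by
  rw [Comp.size, word_map, Finsupp.degree_apply, Finset.sum_eq_multiset_sum,
    ← Finset.sort_eq m.support (· ≤ ·), Multiset.map_coe, Multiset.sum_coe]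

variable {k : Type*} [CommRing k]

/-- A power series is quasisymmetric if pack-equivalent monomials have equal coefficients. -/
def IsQuasisymmetric (f : MvPowerSeries ℕ k) : Prop :=
  ∀ m n, PackEquiv m n → MvPowerSeries.coeff m f = MvPowerSeries.coeff n f

/-- A power series is of bounded degree if all monomials of large degree have coefficient `0`. -/
def HasBoundedDegree (f : MvPowerSeries ℕ k) : Prop :=
  ∃ d : ℕ, ∀ m : ℕ →₀ ℕ, d < m.degree → MvPowerSeries.coeff m f = 0

theorem coeff_mono_mul {ℓ : ℕ} {i : Fin ℓ → ℕ} (hi : Function.Injective i) (a : Fin ℓ → ℕ)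
    (f g : MvPowerSeries ℕ k) :
    MvPowerSeries.coeff (mono i a) (f * g) =
      ∑ p ∈ Fintype.piFinset (fun t => Finset.HasAntidiagonal.antidiagonal (a t)),
        MvPowerSeries.coeff (mono i (fun t => (p t).1)) f *
          MvPowerSeries.coeff (mono i (fun t => (p t).2)) g := by
  classical
  rw [MvPowerSeries.coeff_mul]
  have key : ∀ u v : ℕ →₀ ℕ, u + v = mono i a →
      mono i (fun t => u (i t)) = u ∧ mono i (fun t => v (i t)) = v := by
    intro u v h
    have h' : ∀ x, u x + v x = mono i a x := fun x => by rw [← h]; rfl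
    constructor <;> ext x <;> by_cases hx : ∃ t, i t = x
    · obtain ⟨t, rfl⟩ := hx
      rw [mono_apply hi]
    · push Not at hx
      have := h' x
      rw [mono_apply_of_notMem a hx] at this
      rw [mono_apply_of_notMem _ hx]; omega
    · obtain ⟨t, rfl⟩ := hx
      rw [mono_apply hi]
    · push Not at hx
      have := h' x
      rw [mono_apply_of_notMem a hx] at this
      rw [mono_apply_of_notMem _ hx]; omega
  refine Finset.sum_nbij' (fun uv t => (uv.1 (i t), uv.2 (i t)))
    (fun p => (mono i (fun t => (p t).1), mono i (fun t => (p t).2))) ?_ ?_ ?_ ?_ ?_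
  · rintro ⟨u, v⟩ h
    rw [Finset.HasAntidiagonal.mem_antidiagonal] at h
    simp only [Fintype.mem_piFinset, Finset.HasAntidiagonal.mem_antidiagonal]
    intro t
    rw [← mono_apply hi a t, ← h]; rfl
  · intro p hp
    simp only [Fintype.mem_piFinset, Finset.HasAntidiagonal.mem_antidiagonal] at hp ⊢
    simp only [mono, ← Finset.sum_add_distrib, ← Finsupp.single_add, hp]
  · rintro ⟨u, v⟩ h
    rw [Finset.HasAntidiagonal.mem_antidiagonal] at h
    exact Prod.ext (key u v h).1 (key u v h).2
  · intro p hp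
    ext t <;> simp [mono_apply hi]
  · rintro ⟨u, v⟩ h
    rw [Finset.HasAntidiagonal.mem_antidiagonal] at h
    simp only [(key u v h).1, (key u v h).2]

theorem IsQuasisymmetric.coeff_eq {f : MvPowerSeries ℕ k} (hf : IsQuasisymmetric f)
    {m n : ℕ →₀ ℕ} (h : word m = word n) :
    MvPowerSeries.coeff m f = MvPowerSeries.coeff n f := hf _ _ (packEquiv_iff.2 h)

theorem IsQuasisymmetric.mul {f g : MvPowerSeries ℕ k} (hf : IsQuasisymmetric f)
    (hg : IsQuasisymmetric g) : IsQuasisymmetric (f * g) := by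
  rintro _ _ ⟨ℓ, a, i, j, hi, hj, rfl, rfl⟩
  rw [coeff_mono_mul hi.injective, coeff_mono_mul hj.injective]
  refine Finset.sum_congr rfl fun p _ => ?_
  congr 1
  · exact hf.coeff_eq (coe_list_inj (by rw [word_mono hi, word_mono hj]))
  · exact hg.coeff_eq (coe_list_inj (by rw [word_mono hi, word_mono hj]))

theorem HasBoundedDegree.mul {f g : MvPowerSeries ℕ k} (hf : HasBoundedDegree f)
    (hg : HasBoundedDegree g) : HasBoundedDegree (f * g) := by
  classical
  obtain ⟨d, hd⟩ := hf
  obtain ⟨e, he⟩ := hg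
  refine ⟨d + e, fun m hm => ?_⟩
  rw [MvPowerSeries.coeff_mul]
  refine Finset.sum_eq_zero fun uv huv => ?_
  rw [Finset.HasAntidiagonal.mem_antidiagonal] at huv
  have : uv.1.degree + uv.2.degree = m.degree := by rw [← huv, map_add]
  rcases lt_or_ge d uv.1.degree with h | h
  · rw [hd _ h, zero_mul]
  · rw [he _ (by omega), mul_zero]

theorem isQuasisymmetric_algebraMap (c : k) :
    IsQuasisymmetric (algebraMap k (MvPowerSeries ℕ k) c) := by
  classical
  intro m n h
  have h0 : m = 0 ↔ n = 0 := by
    rw [← word_eq_nil, ← word_eq_nil, packEquiv_iff.1 h]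
  rw [MvPowerSeries.algebraMap_apply, MvPowerSeries.coeff_C, MvPowerSeries.coeff_C]
  simp only [h0]

theorem hasBoundedDegree_algebraMap (c : k) :
    HasBoundedDegree (algebraMap k (MvPowerSeries ℕ k) c) := by
  classical
  refine ⟨0, fun m hm => ?_⟩
  rw [MvPowerSeries.algebraMap_apply, MvPowerSeries.coeff_C, if_neg]
  rintro rfl
  simp at hm

variable (k) in
/-- The `k`-algebra `QSym` of quasisymmetric functions: the quasisymmetric power series
of bounded degree. -/
def QSym : Subalgebra k (MvPowerSeries ℕ k) where
  carrier := {f | IsQuasisymmetric f ∧ HasBoundedDegree f}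
  mul_mem' hf hg := ⟨hf.1.mul hg.1, hf.2.mul hg.2⟩
  add_mem' := by
    rintro f g ⟨hf, d, hd⟩ ⟨hg, e, he⟩
    refine ⟨fun m n h => ?_, max d e, fun m hm => ?_⟩
    · rw [map_add, map_add, hf m n h, hg m n h]
    · rw [map_add, hd _ (lt_of_le_of_lt (le_max_left _ _) hm),
        he _ (lt_of_le_of_lt (le_max_right _ _) hm), add_zero]
  algebraMap_mem' c := ⟨isQuasisymmetric_algebraMap c, hasBoundedDegree_algebraMap c⟩

open Classical in
variable (k) in
/-- The power series `∑ 𝔪`, over all monomials `𝔪` pack-equivalent to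
`x₁^{α₁} x₂^{α₂} ⋯ x_ℓ^{α_ℓ}`. -/
noncomputable def monomialSeries (α : Comp) : MvPowerSeries ℕ k :=
  fun m => if PackEquiv m (mon α) then 1 else 0

theorem coeff_monomialSeries (α : Comp) (m : ℕ →₀ ℕ) :
    MvPowerSeries.coeff m (monomialSeries k α) = if word m = α then 1 else 0 := by
  classical
  change (if _ then (1 : k) else 0) = _
  simp only [packEquiv_iff, word_mon]

variable (k) in
/-- The monomial quasisymmetric function `M_α`. -/
noncomputable def M (α : Comp) : QSym k :=
  ⟨monomialSeries k α, fun m n h => by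
      rw [coeff_monomialSeries, coeff_monomialSeries, packEquiv_iff.1 h],
    Comp.size α, fun m hm => by
      rw [coeff_monomialSeries, if_neg]
      rintro rfl
      exact absurd (degree_eq_size m) hm.ne'⟩

/-- The enriched `q`-monomial function
`η_α^{(q)} = ∑ (q + 1)^{ℓ(β)} M_β`, over all compositions `β` with `|β| = |α|` and
`D(β) ⊆ D(α)`. -/
noncomputable def eta (q : k) (α : Comp) : QSym k :=
  ∑ β ∈ (Comp.ofSize (Comp.size α)).filter (fun β => Comp.D β ⊆ Comp.D α),
    (q + 1) ^ β.length • M k β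

/-! The monomial basis. -/

theorem Comp.finite_size_le (d : ℕ) : {α : Comp | Comp.size α ≤ d}.Finite := by
  refine ((Finset.range (d + 1)).finite_toSet.biUnion
    (fun n _ => Comp.finite_size_eq n)).subset ?_
  intro α hα
  simp only [Set.mem_iUnion]
  exact ⟨Comp.size α, by simpa [Nat.lt_succ_iff] using hα, rfl⟩

variable (k) in
/-- Coordinates with respect to the monomial quasisymmetric functions. -/
noncomputable def coordEquiv : QSym k ≃ₗ[k] (Comp →₀ k) where
  toFun f := Finsupp.ofSupportFinite (fun α => MvPowerSeries.coeff (mon α) f.1) <| by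
    obtain ⟨d, hd⟩ := f.2.2
    refine (Comp.finite_size_le d).subset fun α hα => ?_
    by_contra h
    refine hα (hd _ ?_)
    rw [degree_eq_size, word_mon]
    exact not_le.1 h
  map_add' f g := by ext α; rfl
  map_smul' c f := by ext α; rfl
  invFun c := ⟨fun m => c (word m), fun m n h => by
      change c (word m) = c (word n)
      rw [packEquiv_iff.1 h],
    c.support.sup Comp.size, fun m hm => by
      change c (word m) = 0
      by_contra h
      rw [degree_eq_size] at hm
      exact absurd (Finset.le_sup (f := Comp.size) (Finsupp.mem_support_iff.2 h)) (not_le.2 hm)⟩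
  left_inv f := by
    ext m
    change MvPowerSeries.coeff (mon (word m)) f.1 = MvPowerSeries.coeff m f.1
    exact f.2.1.coeff_eq (word_mon _)
  right_inv c := by
    ext α
    change c (word (mon α)) = c α
    rw [word_mon]

variable (k) in
/-- The monomial basis `(M_α)` of `QSym`. -/
noncomputable def basisM : Module.Basis Comp k (QSym k) := .ofRepr (coordEquiv k)

theorem basisM_repr (f : QSym k) (α : Comp) :
    (basisM k).repr f α = MvPowerSeries.coeff (mon α) f.1 := rfl

theorem basisM_apply (α : Comp) : basisM k α = M k α := by
  apply (basisM k).repr.injective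
  ext β
  rw [Module.Basis.repr_self, basisM_repr]
  change _ = MvPowerSeries.coeff (mon β) (monomialSeries k α)
  classical
  rw [coeff_monomialSeries, word_mon, Finsupp.single_apply]
  simp only [eq_comm]

theorem repr_M (α β : Comp) : (basisM k).repr (M k α) β = if α = β then 1 else 0 := by
  classical
  rw [← basisM_apply, Module.Basis.repr_self, Finsupp.single_apply]

theorem M_nil : M k [] = 1 := by
  apply Subtype.ext
  ext m
  change MvPowerSeries.coeff m (monomialSeries k []) = MvPowerSeries.coeff m 1
  classical
  rw [coeff_monomialSeries, MvPowerSeries.coeff_one]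
  simp only [word_eq_nil]

/-! The coalgebra structure. -/

variable (k) in
/-- The comultiplication: `Δ(M_α) = ∑ M_β ⊗ M_γ`, over all pairs of compositions with `α = βγ`. -/
noncomputable def comulLin : QSym k →ₗ[k] QSym k ⊗[k] QSym k :=
  (basisM k).constr k fun α =>
    ∑ i ∈ Finset.range (α.length + 1), M k (α.take i) ⊗ₜ[k] M k (α.drop i)

variable (k) in
/-- The counit: the constant term. -/
noncomputable def counitLin : QSym k →ₗ[k] k :=
  MvPowerSeries.coeff (0 : ℕ →₀ ℕ) ∘ₗ (QSym k).val.toLinearMap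

noncomputable instance : CoalgebraStruct k (QSym k) where
  comul := comulLin k
  counit := counitLin k

theorem comul_M (α : Comp) : Coalgebra.comul (R := k) (M k α) =
    ∑ i ∈ Finset.range (α.length + 1), M k (α.take i) ⊗ₜ[k] M k (α.drop i) := by
  change comulLin k (M k α) = _
  rw [comulLin, ← basisM_apply, Module.Basis.constr_basis]

theorem counit_eq (f : QSym k) :
    Coalgebra.counit (R := k) f = MvPowerSeries.coeff 0 f.1 := rfl

theorem counit_M (α : Comp) :
    Coalgebra.counit (R := k) (M k α) = if α = [] then 1 else 0 := by
  rw [counit_eq]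
  change MvPowerSeries.coeff 0 (monomialSeries k α) = _
  rw [coeff_monomialSeries, (word_eq_nil 0).2 rfl]
  simp only [eq_comm]

variable (k) in
/-- The basis `(M_α ⊗ M_β)` of `QSym ⊗ QSym`. -/
noncomputable def basisM₂ : Module.Basis (Comp × Comp) k (QSym k ⊗[k] QSym k) :=
  (basisM k).tensorProduct (basisM k)

theorem basisM₂_repr_tmul (x y : QSym k) (α β : Comp) :
    (basisM₂ k).repr (x ⊗ₜ[k] y) (α, β) = (basisM k).repr x α * (basisM k).repr y β := by
  rw [basisM₂, Module.Basis.tensorProduct_repr_tmul_apply, smul_eq_mul, mul_comm]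

theorem basisM₂_repr_comul (f : QSym k) (α β : Comp) :
    (basisM₂ k).repr (Coalgebra.comul (R := k) f) (α, β) = (basisM k).repr f (α ++ β) := by
  have key : (basisM₂ k).coord (α, β) ∘ₗ Coalgebra.comul (R := k) (A := QSym k) =
      (basisM k).coord (α ++ β) := by
    refine (basisM k).ext fun γ => ?_
    rw [basisM_apply, LinearMap.comp_apply, comul_M, map_sum, Module.Basis.coord_apply, repr_M]
    simp only [Module.Basis.coord_apply, basisM₂_repr_tmul, repr_M]
    split_ifs with h
    · subst h
      rw [Finset.sum_eq_single α.length]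
      · simp
      · intro i hi hne
        rw [if_neg, zero_mul]
        intro h
        apply hne
        have := congrArg List.length h
        rw [List.length_take] at this
        simp only [Finset.mem_range] at hi
        omega
      · intro h
        simp at h
    · refine Finset.sum_eq_zero fun i _ => ?_
      by_cases h1 : γ.take i = α
      · rw [if_neg (fun h2 : γ.drop i = β => h ?_), mul_zero]
        rw [← h1, ← h2, List.take_append_drop]
      · rw [if_neg h1, zero_mul]
  exact LinearMap.congr_fun key f

theorem basisM₂_ext {X Y : QSym k ⊗[k] QSym k}
    (h : ∀ α β, (basisM₂ k).repr X (α, β) = (basisM₂ k).repr Y (α, β)) : X = Y :=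
  (basisM₂ k).ext_elem fun p => h p.1 p.2

variable (k) in
/-- The basis `(M_α ⊗ (M_β ⊗ M_γ))` of `QSym ⊗ (QSym ⊗ QSym)`. -/
noncomputable def basisM₃ :
    Module.Basis (Comp × (Comp × Comp)) k (QSym k ⊗[k] (QSym k ⊗[k] QSym k)) :=
  (basisM k).tensorProduct (basisM₂ k)

theorem basisM₃_repr_tmul (x : QSym k) (Y : QSym k ⊗[k] QSym k) (α : Comp) (p : Comp × Comp) :
    (basisM₃ k).repr (x ⊗ₜ[k] Y) (α, p) = (basisM k).repr x α * (basisM₂ k).repr Y p := by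
  rw [basisM₃, Module.Basis.tensorProduct_repr_tmul_apply, smul_eq_mul, mul_comm]

theorem basisM₃_repr_lTensor (X : QSym k ⊗[k] QSym k) (α β γ : Comp) :
    (basisM₃ k).repr ((Coalgebra.comul (R := k) (A := QSym k)).lTensor (QSym k) X) (α, (β, γ)) =
      (basisM₂ k).repr X (α, β ++ γ) := by
  induction X with
  | zero => rw [LinearMap.map_zero, LinearEquiv.map_zero, LinearEquiv.map_zero]; rfl
  | add X Y hX hY => rw [map_add, map_add, map_add, Finsupp.add_apply, Finsupp.add_apply, hX, hY]
  | tmul x y =>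
    rw [LinearMap.lTensor_tmul, basisM₃_repr_tmul, basisM₂_repr_comul, basisM₂_repr_tmul]

theorem basisM₃_repr_assoc (Z : QSym k ⊗[k] QSym k) (y : QSym k) (α β γ : Comp) :
    (basisM₃ k).repr (TensorProduct.assoc k (QSym k) (QSym k) (QSym k) (Z ⊗ₜ[k] y)) (α, (β, γ)) =
      (basisM₂ k).repr Z (α, β) * (basisM k).repr y γ := by
  induction Z with
  | zero =>
    rw [TensorProduct.zero_tmul, LinearEquiv.map_zero, LinearEquiv.map_zero, LinearEquiv.map_zero,
      Finsupp.zero_apply, Finsupp.zero_apply, zero_mul]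
  | add X Y hX hY =>
    rw [TensorProduct.add_tmul, map_add, map_add, map_add, Finsupp.add_apply, Finsupp.add_apply,
      hX, hY, add_mul]
  | tmul x z =>
    rw [TensorProduct.assoc_tmul, basisM₃_repr_tmul, basisM₂_repr_tmul, basisM₂_repr_tmul,
      mul_assoc]

theorem basisM₃_repr_rTensor (X : QSym k ⊗[k] QSym k) (α β γ : Comp) :
    (basisM₃ k).repr (TensorProduct.assoc k (QSym k) (QSym k) (QSym k)
        ((Coalgebra.comul (R := k) (A := QSym k)).rTensor (QSym k) X)) (α, (β, γ)) =
      (basisM₂ k).repr X (α ++ β, γ) := by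
  induction X with
  | zero =>
    rw [LinearMap.map_zero, LinearEquiv.map_zero, LinearEquiv.map_zero, LinearEquiv.map_zero]; rfl
  | add X Y hX hY =>
    rw [map_add, map_add, map_add, map_add, Finsupp.add_apply, Finsupp.add_apply, hX, hY]
  | tmul x y =>
    rw [LinearMap.rTensor_tmul, basisM₃_repr_assoc, basisM₂_repr_comul, basisM₂_repr_tmul]

theorem counit_eq_repr (f : QSym k) :
    Coalgebra.counit (R := k) f = (basisM k).repr f [] := by
  rw [counit_eq, basisM_repr]
  congr 1

theorem repr_lid_rTensor (X : QSym k ⊗[k] QSym k) (β : Comp) :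
    (basisM k).repr (TensorProduct.lid k (QSym k)
      ((Coalgebra.counit (R := k) (A := QSym k)).rTensor (QSym k) X)) β =
      (basisM₂ k).repr X ([], β) := by
  induction X with
  | zero => simp
  | add X Y hX hY =>
    rw [map_add, map_add, map_add, map_add, Finsupp.add_apply, Finsupp.add_apply, hX, hY]
  | tmul x y =>
    rw [LinearMap.rTensor_tmul, TensorProduct.lid_tmul, counit_eq_repr, basisM₂_repr_tmul,
      map_smul, Finsupp.smul_apply, smul_eq_mul]

theorem repr_rid_lTensor (X : QSym k ⊗[k] QSym k) (α : Comp) :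
    (basisM k).repr (TensorProduct.rid k (QSym k)
      ((Coalgebra.counit (R := k) (A := QSym k)).lTensor (QSym k) X)) α =
      (basisM₂ k).repr X (α, []) := by
  induction X with
  | zero => simp
  | add X Y hX hY =>
    rw [map_add, map_add, map_add, map_add, Finsupp.add_apply, Finsupp.add_apply, hX, hY]
  | tmul x y =>
    rw [LinearMap.lTensor_tmul, TensorProduct.rid_tmul, counit_eq_repr, basisM₂_repr_tmul,
      map_smul, Finsupp.smul_apply, smul_eq_mul, mul_comm]

noncomputable instance : Coalgebra k (QSym k) where
  coassoc := by
    ext1 f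
    refine (basisM₃ k).ext_elem fun p => ?_
    obtain ⟨α, β, γ⟩ := p
    change (basisM₃ k).repr (TensorProduct.assoc k (QSym k) (QSym k) (QSym k)
        ((Coalgebra.comul (R := k) (A := QSym k)).rTensor (QSym k) _)) _ =
      (basisM₃ k).repr ((Coalgebra.comul (R := k) (A := QSym k)).lTensor (QSym k) _) _
    rw [basisM₃_repr_rTensor, basisM₃_repr_lTensor, basisM₂_repr_comul, basisM₂_repr_comul,
      List.append_assoc]
  rTensor_counit_comp_comul := by
    ext1 f
    apply (TensorProduct.lid k (QSym k)).injective
    refine (basisM k).ext_elem fun β => ?_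
    rw [LinearMap.comp_apply, repr_lid_rTensor, basisM₂_repr_comul, List.nil_append]
    simp
  lTensor_counit_comp_comul := by
    ext1 f
    apply (TensorProduct.rid k (QSym k)).injective
    refine (basisM k).ext_elem fun β => ?_
    rw [LinearMap.comp_apply, repr_rid_lTensor, basisM₂_repr_comul, List.append_nil]
    simp

/-! The bialgebra structure. -/

/-- The sequence of nonzero entries of a tuple. -/
noncomputable def tupleWord {n : ℕ} (a : Fin n → ℕ) : Comp := word (mono (fun t => (t : ℕ)) a)

theorem tupleWord_append {n m : ℕ} (a : Fin n → ℕ) (b : Fin m → ℕ) :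
    tupleWord (Fin.append a b) = tupleWord a ++ tupleWord b := by
  apply coe_list_inj
  rw [List.map_append]
  simp only [tupleWord, word_mono Fin.val_strictMono]
  rw [List.ofFn_fin_append, List.filter_append]

theorem tupleWord_get (α : Comp) : tupleWord (fun t => (α.get t : ℕ)) = α := word_mon α

theorem repr_tupleWord (f : QSym k) {n : ℕ} (a : Fin n → ℕ) :
    (basisM k).repr f (tupleWord a) = MvPowerSeries.coeff (mono (fun t => (t : ℕ)) a) f.1 := by
  rw [basisM_repr]
  exact f.2.1.coeff_eq (word_mon _)

/-- All ways of writing a tuple as the sum of two tuples. -/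
def splits {n : ℕ} (a : Fin n → ℕ) : Finset (Fin n → ℕ × ℕ) :=
  Fintype.piFinset (fun t => Finset.HasAntidiagonal.antidiagonal (a t))

theorem repr_mul (f g : QSym k) {n : ℕ} (a : Fin n → ℕ) :
    (basisM k).repr (f * g) (tupleWord a) =
      ∑ p ∈ splits a, (basisM k).repr f (tupleWord fun t => (p t).1) *
        (basisM k).repr g (tupleWord fun t => (p t).2) := by
  simp only [repr_tupleWord]
  exact coeff_mono_mul Fin.val_injective a f.1 g.1

theorem sum_splits_append {n m : ℕ} (a : Fin n → ℕ) (b : Fin m → ℕ)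
    (F : (Fin (n + m) → ℕ × ℕ) → k) :
    ∑ p ∈ splits (Fin.append a b), F p = ∑ p ∈ splits a, ∑ q ∈ splits b, F (Fin.append p q) := by
  rw [← Finset.sum_product']
  refine Finset.sum_nbij' (fun p => (fun t => p (Fin.castAdd m t), fun t => p (Fin.natAdd n t)))
    (fun pq => Fin.append pq.1 pq.2) ?_ ?_ ?_ ?_ ?_
  · intro p hp
    simp only [splits, Fintype.mem_piFinset, Finset.mem_product] at hp ⊢
    exact ⟨fun t => by simpa using hp (Fin.castAdd m t), fun t => by simpa using hp (Fin.natAdd n t)⟩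
  · intro pq hpq
    simp only [splits, Fintype.mem_piFinset, Finset.mem_product] at hpq ⊢
    intro t
    refine Fin.addCases (fun t => ?_) (fun t => ?_) t
    · rw [Fin.append_left, Fin.append_left]; exact hpq.1 t
    · rw [Fin.append_right, Fin.append_right]; exact hpq.2 t
  · intro p _
    exact Fin.append_castAdd_natAdd
  · intro pq _
    simp
  · intro p _
    congr 1
    exact Fin.append_castAdd_natAdd.symm

theorem basisM₂_repr_mul (X Y : QSym k ⊗[k] QSym k) {n m : ℕ} (a : Fin n → ℕ) (b : Fin m → ℕ) :
    (basisM₂ k).repr (X * Y) (tupleWord a, tupleWord b) =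
      ∑ p ∈ splits a, ∑ q ∈ splits b,
        (basisM₂ k).repr X (tupleWord fun t => (p t).1, tupleWord fun t => (q t).1) *
          (basisM₂ k).repr Y (tupleWord fun t => (p t).2, tupleWord fun t => (q t).2) := by
  induction X with
  | zero => simp
  | add X X' hX hX' =>
    simp only [add_mul, map_add, Finsupp.add_apply, Finset.sum_add_distrib, hX, hX']
  | tmul x y =>
    induction Y with
    | zero => simp
    | add Y Y' hY hY' =>
      simp only [mul_add, map_add, Finsupp.add_apply, Finset.sum_add_distrib, hY, hY']
    | tmul z w =>
      rw [Algebra.TensorProduct.tmul_mul_tmul, basisM₂_repr_tmul, repr_mul, repr_mul,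
        Finset.sum_mul_sum]
      refine Finset.sum_congr rfl fun p _ => Finset.sum_congr rfl fun q _ => ?_
      rw [basisM₂_repr_tmul, basisM₂_repr_tmul]
      ring

theorem comp_append {n m : ℕ} (p : Fin n → ℕ × ℕ) (q : Fin m → ℕ × ℕ) (h : ℕ × ℕ → ℕ) :
    (fun t => h (Fin.append p q t)) = Fin.append (fun t => h (p t)) (fun t => h (q t)) := by
  ext t
  refine Fin.addCases (fun t => ?_) (fun t => ?_) t <;> simp

theorem comul_mul' (f g : QSym k) : Coalgebra.comul (R := k) (f * g) =
    Coalgebra.comul (R := k) f * Coalgebra.comul (R := k) g := by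
  refine basisM₂_ext fun α β => ?_
  rw [← tupleWord_get α, ← tupleWord_get β, basisM₂_repr_mul, basisM₂_repr_comul,
    ← tupleWord_append, repr_mul, sum_splits_append]
  refine Finset.sum_congr rfl fun p _ => Finset.sum_congr rfl fun q _ => ?_
  rw [basisM₂_repr_comul, basisM₂_repr_comul, comp_append p q Prod.fst, comp_append p q Prod.snd,
    tupleWord_append, tupleWord_append]

noncomputable instance : Bialgebra k (QSym k) :=
  Bialgebra.mk' k (QSym k)
    (by rw [← M_nil, counit_M, if_pos rfl])
    (by
      intro f g
      rw [counit_eq, counit_eq, counit_eq]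
      exact map_mul (MvPowerSeries.constantCoeff (σ := ℕ) (R := k)) f.1 g.1)
    (by
      rw [← M_nil, comul_M]
      simp [M_nil, Algebra.TensorProduct.one_def])
    (by
      intro f g
      exact comul_mul' f g)

/-! The antipode, obtained as a convolution inverse of the identity. -/

variable (k) in
/-- The recursion `S(M_α) = - ∑ S(M_β) M_γ`, over `α = βγ` with `γ` nonempty, and `S(1) = 1`. -/
noncomputable def antipodeL (α : Comp) : QSym k :=
  if α = [] then 1 else -∑ i : Fin α.length, antipodeL (α.take i) * M k (α.drop i)
termination_by α.length
decreasing_by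
  rw [List.length_take]
  omega

variable (k) in
/-- The recursion `S(M_α) = - ∑ M_β S(M_γ)`, over `α = βγ` with `β` nonempty, and `S(1) = 1`. -/
noncomputable def antipodeR (α : Comp) : QSym k :=
  if α = [] then 1 else
    -∑ i : Fin α.length, M k (α.take (i + 1)) * antipodeR (α.drop (i + 1))
termination_by α.length
decreasing_by
  rw [List.length_drop]
  omega

variable (k) in
/-- The antipode of `QSym`: the left convolution inverse of the identity. It is shown below to be a
two-sided inverse, hence it is the unique one. -/
noncomputable def antipodeLin : QSym k →ₗ[k] QSym k := (basisM k).constr k (antipodeL k)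

variable (k) in
/-- The right convolution inverse of the identity. -/
noncomputable def antipodeLinR : QSym k →ₗ[k] QSym k := (basisM k).constr k (antipodeR k)

open WithConv in
theorem antipodeLin_mul_id :
    toConv (antipodeLin k) * toConv (LinearMap.id : QSym k →ₗ[k] QSym k) = 1 := by
  apply ofConv_injective
  refine (basisM k).ext fun α => ?_
  rw [basisM_apply]
  change LinearMap.mul' k (QSym k) (TensorProduct.map (antipodeLin k) LinearMap.id
    (Coalgebra.comul (R := k) (M k α))) =
      algebraMap k (QSym k) (Coalgebra.counit (R := k) (M k α))
  have hS : ∀ β, antipodeLin k (M k β) = antipodeL k β := fun β => by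
    rw [antipodeLin, ← basisM_apply, Module.Basis.constr_basis]
  rw [comul_M, counit_M]
  simp only [map_sum, TensorProduct.map_tmul, LinearMap.mul'_apply, LinearMap.id_apply, hS]
  rw [Finset.sum_range_succ, List.take_length, List.drop_length, M_nil, mul_one,
    Finset.sum_range (fun i => antipodeL k (α.take i) * M k (α.drop i))]
  conv_lhs => enter [2]; rw [antipodeL]
  split_ifs with h
  · subst h
    simp
  · rw [add_neg_cancel, map_zero]

open WithConv in
theorem id_mul_antipodeLinR :
    toConv (LinearMap.id : QSym k →ₗ[k] QSym k) * toConv (antipodeLinR k) = 1 := by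
  apply ofConv_injective
  refine (basisM k).ext fun α => ?_
  rw [basisM_apply]
  change LinearMap.mul' k (QSym k) (TensorProduct.map LinearMap.id (antipodeLinR k)
    (Coalgebra.comul (R := k) (M k α))) =
      algebraMap k (QSym k) (Coalgebra.counit (R := k) (M k α))
  have hS : ∀ β, antipodeLinR k (M k β) = antipodeR k β := fun β => by
    rw [antipodeLinR, ← basisM_apply, Module.Basis.constr_basis]
  rw [comul_M, counit_M]
  simp only [map_sum, TensorProduct.map_tmul, LinearMap.mul'_apply, LinearMap.id_apply, hS]
  rw [Finset.sum_range_succ', List.take_zero, List.drop_zero, M_nil, one_mul,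
    Finset.sum_range (fun i => M k (α.take (i + 1)) * antipodeR k (α.drop (i + 1)))]
  conv_lhs => enter [2]; rw [antipodeR]
  split_ifs with h
  · subst h
    simp
  · rw [add_neg_cancel, map_zero]

/-- The Hopf algebra `QSym`. -/
noncomputable instance : HopfAlgebra k (QSym k) :=
  HopfAlgebra.ofConvInverse (antipodeLin k) antipodeLin_mul_id (by
    rw [left_inv_eq_right_inv (antipodeLin_mul_id (k := k)) id_mul_antipodeLinR]
    exact id_mul_antipodeLinR)

end QSymFn

/-!
The antipode of an enriched `q`-monomial function is computed in the convolution algebra of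
`k`-linear endomorphisms of `QSym`.

Cutting a coarsening of `α` at one of its partial sums is the same as cutting `α` there and coarsening
both parts (`Comp.coarsens_append_iff`), so `η^{(q)}` obeys the same coproduct rule as the
monomial basis: `Δ η_α = ∑_{α = βγ} η_β ⊗ η_γ`.  In other words, `φ : M_α ↦ η_α^{(q)}` is an
endomorphism of the coalgebra `QSym` (`etaCoalgHom`), and hence `S ∘ φ` is the convolution inverse
of `φ`.  The theorem says that the linear map `ψ : M_α ↦ (-q)^{ℓ(α)} η_{rev α}^{(p)}` is this inverse,
and it remains to show `ψ * φ = 1`.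

For a composition `β`, write `φ_β`, `ψ_β` for the functionals "coefficient of `M_β` in `φ`, `ψ`".
In the convolution algebra of functionals, `φ_{βγ} = φ_β * φ_γ` while `ψ_{βγ} = ψ_γ * ψ_β`, because
of the reversal.  The coefficient of `M_β` in a product is a sum over all ways to write `β`
entrywise as `b' + b''`, zeros being dropped (`repr_mul`).  For `β = (c, …)` the coefficient of
`ψ * φ` is therefore a sum of terms `ψ_{…} * (∑_{a + b = c} ψ_a * φ_b) * φ_{…}`, and the middle
factor vanishes (`sum_etaRevCoeff_mul_etaCoeff_eq_zero`).  To see why, restrict to one variable `x`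
and encode `M_α` by the noncommutative monomial `t_{α₁} ⋯ t_{α_ℓ}`: with `A = ∑_n x^n t_n`, the map
`φ` has generating function `1 + (q + 1) A / (1 - A) = (1 + q A) / (1 - A)`, and `ψ`, as `p q = 1`,
has `(1 - p q A) / (1 + q A) = (1 - A) / (1 + q A)`.  On coefficients, that the two are inverse to
each other is the telescoping sum `sum_neg_pow_mul_eq_zero`, the only place where `p q = 1` enters.
-/

namespace QSymFn

open scoped TensorProduct
open WithConv

/-! ### Coarsenings of compositions -/

theorem Comp.size_append (α β : Comp) : Comp.size (α ++ β) = Comp.size α + Comp.size β := by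
  simp [Comp.size]

theorem Comp.size_singleton (c : ℕ+) : Comp.size [c] = c := by
  simp [Comp.size]

theorem Comp.size_eq_zero {α : Comp} : Comp.size α = 0 ↔ α = [] := by
  cases α <;> simp [Comp.size]

/-- Two prefixes of the same composition are comparable by size, as all entries are positive. -/
theorem Comp.prefix_of_size_le {α β γ : Comp} (hα : α <+: γ) (hβ : β <+: γ)
    (h : Comp.size α ≤ Comp.size β) : α <+: β := by
  rcases List.prefix_or_prefix_of_prefix hα hβ with h' | ⟨δ, rfl⟩
  · exact h'
  · rw [Comp.size_append] at h
    rw [Comp.size_eq_zero.1 (by omega : Comp.size δ = 0), List.append_nil]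

theorem Comp.size_le_of_prefix {α β : Comp} (h : α <+: β) : Comp.size α ≤ Comp.size β := by
  obtain ⟨δ, rfl⟩ := h
  rw [Comp.size_append]
  omega

theorem Comp.mem_D {α : Comp} {s : ℕ} :
    s ∈ Comp.D α ↔ 0 < s ∧ s < Comp.size α ∧ ∃ β, β <+: α ∧ Comp.size β = s := by
  simp only [Comp.D, Finset.mem_image, Finset.mem_Ico]
  constructor
  · rintro ⟨i, ⟨hi, hi'⟩, rfl⟩
    have h := Comp.size_append (α.take i) (α.drop i)
    rw [List.take_append_drop] at h
    have h1 : Comp.size (α.take i) ≠ 0 := fun h0 => by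
      have := congrArg List.length (Comp.size_eq_zero.1 h0)
      rw [List.length_take, List.length_nil] at this
      omega
    have h2 : Comp.size (α.drop i) ≠ 0 := fun h0 => by
      have := congrArg List.length (Comp.size_eq_zero.1 h0)
      rw [List.length_drop, List.length_nil] at this
      omega
    exact ⟨by omega, by omega, _, List.take_prefix _ _, rfl⟩
  · rintro ⟨h0, h1, β, ⟨γ, rfl⟩, rfl⟩
    refine ⟨β.length, ⟨?_, ?_⟩, by simp⟩
    · rw [Nat.one_le_iff_ne_zero, Ne, List.length_eq_zero_iff, ← Comp.size_eq_zero]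
      omega
    · rw [Comp.size_append] at h1
      have : γ.length ≠ 0 := by
        rw [Ne, List.length_eq_zero_iff, ← Comp.size_eq_zero]
        omega
      rw [List.length_append]
      omega

/-- `β` is a coarsening of `α`: it has the same size, and its partial sums are partial sums
of `α`. -/
def Comp.Coarsens (β α : Comp) : Prop :=
  Comp.size β = Comp.size α ∧ Comp.D β ⊆ Comp.D α

theorem Comp.coarsens_iff {β α : Comp} : Comp.Coarsens β α ↔
    Comp.size β = Comp.size α ∧ ∀ δ, δ <+: β → ∃ ε, ε <+: α ∧ Comp.size ε = Comp.size δ := by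
  refine and_congr_right fun hs => ⟨fun h δ hδ => ?_, fun h s hs' => ?_⟩
  · rcases Nat.eq_zero_or_pos (Comp.size δ) with h0 | h0
    · exact ⟨[], List.nil_prefix, h0.symm⟩
    rcases (Comp.size_le_of_prefix hδ).eq_or_lt with h1 | h1
    · exact ⟨α, List.prefix_rfl, by omega⟩
    · exact (Comp.mem_D.1 (h (Comp.mem_D.2 ⟨h0, h1, δ, hδ, rfl⟩))).2.2
  · obtain ⟨h0, h1, δ, hδ, rfl⟩ := Comp.mem_D.1 hs'
    exact Comp.mem_D.2 ⟨h0, by omega, h δ hδ⟩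

theorem Comp.Coarsens.append {β γ α α' : Comp} (h : Comp.Coarsens β α) (h' : Comp.Coarsens γ α') :
    Comp.Coarsens (β ++ γ) (α ++ α') := by
  rw [Comp.coarsens_iff] at *
  refine ⟨by rw [Comp.size_append, Comp.size_append, h.1, h'.1], fun δ hδ => ?_⟩
  rcases List.prefix_or_prefix_of_prefix hδ (List.prefix_append β γ) with h1 | ⟨ρ, rfl⟩
  · obtain ⟨ε, hε, hs⟩ := h.2 δ h1
    exact ⟨ε, hε.trans (List.prefix_append _ _), hs⟩
  · obtain ⟨ε, hε, hs⟩ := h'.2 ρ ((List.prefix_append_right_inj β).1 hδ)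
    exact ⟨α ++ ε, (List.prefix_append_right_inj α).2 hε, by
      rw [Comp.size_append, Comp.size_append, hs, h.1]⟩

/-- The coarsenings of `α` with a cut at `|β|` are the concatenations of coarsenings of the two parts
into which `α` is cut there. -/
theorem Comp.coarsens_append_iff {β γ α : Comp} : Comp.Coarsens (β ++ γ) α ↔
    ∃ α₁ α₂, α₁ ++ α₂ = α ∧ Comp.Coarsens β α₁ ∧ Comp.Coarsens γ α₂ := by
  refine ⟨fun h => ?_, ?_⟩
  · rw [Comp.coarsens_iff] at h
    obtain ⟨hs, h⟩ := h
    obtain ⟨α₁, ⟨α₂, rfl⟩, h1⟩ := h β (List.prefix_append _ _)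
    rw [Comp.size_append, Comp.size_append] at hs
    refine ⟨α₁, α₂, rfl, Comp.coarsens_iff.2 ⟨h1.symm, fun δ hδ => ?_⟩,
      Comp.coarsens_iff.2 ⟨by omega, fun δ hδ => ?_⟩⟩
    · obtain ⟨ε, hε, h2⟩ := h δ (hδ.trans (List.prefix_append _ _))
      have := Comp.size_le_of_prefix hδ
      exact ⟨ε, Comp.prefix_of_size_le hε (List.prefix_append _ _) (by omega), h2⟩
    · obtain ⟨ε, hε, h2⟩ := h (β ++ δ) ((List.prefix_append_right_inj β).2 hδ)
      rw [Comp.size_append] at h2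
      obtain ⟨ρ, rfl⟩ := Comp.prefix_of_size_le (List.prefix_append α₁ α₂) hε (by omega)
      rw [Comp.size_append] at h2
      exact ⟨ρ, (List.prefix_append_right_inj α₁).1 hε, by omega⟩
  · rintro ⟨α₁, α₂, rfl, h1, h2⟩
    exact h1.append h2

theorem Comp.nil_coarsens_iff {α : Comp} : Comp.Coarsens [] α ↔ α = [] := by
  constructor
  · exact fun h => Comp.size_eq_zero.1 h.1.symm
  · rintro rfl
    exact ⟨rfl, subset_rfl⟩

theorem Comp.singleton_coarsens_iff {c : ℕ+} {α : Comp} :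
    Comp.Coarsens [c] α ↔ Comp.size α = c := by
  rw [Comp.Coarsens, Comp.size_singleton]
  constructor
  · exact fun h => h.1.symm
  · exact fun h => ⟨h.symm, by simp [Comp.D]⟩

/-! ### Coefficients of the enriched monomial functions -/

variable {k : Type*} [CommRing k]

open Classical in
theorem repr_eta (q : k) (α β : Comp) :
    (basisM k).repr (eta q α) β = if Comp.Coarsens β α then (q + 1) ^ β.length else 0 := by
  rw [eta, map_sum, Finsupp.finsetSum_apply]
  simp only [map_smul, Finsupp.smul_apply, repr_M, smul_eq_mul, mul_ite, mul_one, mul_zero]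
  rw [Finset.sum_ite_eq']
  exact if_congr (by rw [Finset.mem_filter, Comp.mem_ofSize, Comp.Coarsens]) rfl rfl

theorem repr_eta_nil (q : k) (α : Comp) :
    (basisM k).repr (eta q α) [] = if α = [] then 1 else 0 := by
  classical
  simp [repr_eta, Comp.nil_coarsens_iff]

theorem repr_eta_singleton (q : k) (α : Comp) (c : ℕ+) :
    (basisM k).repr (eta q α) [c] = if Comp.size α = c then q + 1 else 0 := by
  classical
  simp [repr_eta, Comp.singleton_coarsens_iff]

/-- The coproduct rule `Δ η_α = ∑_{α = βγ} η_β ⊗ η_γ`, on coefficients. -/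
theorem repr_eta_append (q : k) (α β γ : Comp) :
    (basisM k).repr (eta q α) (β ++ γ) = ∑ i ∈ Finset.range (α.length + 1),
      (basisM k).repr (eta q (α.take i)) β * (basisM k).repr (eta q (α.drop i)) γ := by
  classical
  simp only [repr_eta]
  by_cases h : Comp.Coarsens (β ++ γ) α
  · obtain ⟨α₁, α₂, rfl, h1, h2⟩ := Comp.coarsens_append_iff.1 h
    rw [if_pos h, Finset.sum_eq_single α₁.length]
    · rw [List.take_left, List.drop_left, if_pos h1, if_pos h2, List.length_append, pow_add]
    · intro i hi hne
      rw [if_neg, zero_mul]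
      -- Only the cut at the partial sum `|β|` contributes.
      intro h3
      apply hne
      have hs : Comp.size ((α₁ ++ α₂).take i) = Comp.size α₁ := h3.1.symm.trans h1.1
      have e1 := Comp.prefix_of_size_le (List.take_prefix i _) (List.prefix_append α₁ α₂) hs.le
      have e2 := Comp.prefix_of_size_le (List.prefix_append α₁ α₂) (List.take_prefix i _) hs.ge
      have := e1.length_le
      have := e2.length_le
      rw [List.length_take] at *
      rw [Finset.mem_range] at hi
      omega
    · intro h
      exact absurd (by simp) h
  · rw [if_neg h]
    refine (Finset.sum_eq_zero fun i _ => ?_).symm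
    by_cases h1 : Comp.Coarsens β (α.take i)
    · rw [if_neg (c := Comp.Coarsens γ _) fun h2 =>
        h (by simpa only [List.take_append_drop] using h1.append h2), mul_zero]
    · rw [if_neg h1, zero_mul]

/-! ### The coalgebra endomorphism given by the enriched monomial functions -/

/-- The linear map `M_α ↦ η_α^{(q)}`. -/
noncomputable def etaLin (q : k) : QSym k →ₗ[k] QSym k := (basisM k).constr k (eta q)

theorem etaLin_M (q : k) (α : Comp) : etaLin q (M k α) = eta q α := by
  rw [etaLin, ← basisM_apply, Module.Basis.constr_basis]

/-- The linear map `M_α ↦ η_α^{(q)}`, as a homomorphism of coalgebras. -/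
noncomputable def etaCoalgHom (q : k) : QSym k →ₗc[k] QSym k where
  __ := etaLin q
  counit_comp := by
    refine (basisM k).ext fun α => ?_
    rw [basisM_apply, LinearMap.comp_apply, counit_M, counit_eq_repr]
    exact (congrArg (fun f => (basisM k).repr f []) (etaLin_M q α)).trans (repr_eta_nil q α)
  map_comp_comul := by
    refine (basisM k).ext fun α => basisM₂_ext fun β γ => ?_
    rw [basisM_apply]
    change (basisM₂ k).repr (TensorProduct.map (etaLin q) (etaLin q) (Coalgebra.comul (M k α)))
      (β, γ) = (basisM₂ k).repr (Coalgebra.comul (etaLin q (M k α))) (β, γ)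
    rw [basisM₂_repr_comul, etaLin_M, repr_eta_append, comul_M]
    simp only [map_sum, Finsupp.finsetSum_apply, TensorProduct.map_tmul, basisM₂_repr_tmul,
      etaLin_M]

theorem etaLin_convMul_antipode_comp (q : k) :
    toConv (etaLin q) * toConv (HopfAlgebra.antipode k ∘ₗ etaLin q) = 1 := by
  have h := LinearMap.convMul_comp_coalgHom_distrib
    (toConv (LinearMap.id : QSym k →ₗ[k] QSym k)) (toConv (HopfAlgebra.antipode k))
    (etaCoalgHom q)
  refine Eq.trans (b := toConv (ofConv (1 : WithConv (QSym k →ₗ[k] QSym k)) ∘ₗ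
    (etaCoalgHom q).toLinearMap)) ?_ ?_
  · rw [← LinearMap.id_mul_antipode, h]
    rfl
  · refine congrArg toConv ?_
    ext1 f
    exact congrArg (algebraMap k (QSym k)) (LinearMap.congr_fun (etaCoalgHom q).counit_comp f)

/-! ### Coefficient functionals -/

theorem convMul_apply_M {A : Type*} [Ring A] [Algebra k A] (f g : QSym k →ₗ[k] A) (α : Comp) :
    (toConv f * toConv g) (M k α) =
      ∑ i ∈ Finset.range (α.length + 1), f (M k (α.take i)) * g (M k (α.drop i)) := by
  rw [LinearMap.convMul_apply, comul_M]
  simp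

/-- The linear map `M_α ↦ (-q)^{ℓ(α)} η_{rev α}^{(p)}`. -/
noncomputable def etaRevLin (p q : k) : QSym k →ₗ[k] QSym k :=
  (basisM k).constr k fun α => (-q) ^ α.length • eta p α.reverse

theorem etaRevLin_M (p q : k) (α : Comp) :
    etaRevLin p q (M k α) = (-q) ^ α.length • eta p α.reverse := by
  rw [etaRevLin, ← basisM_apply, Module.Basis.constr_basis]

/-- The functional sending `f` to the coefficient of `M_β` in `etaLin q f`. -/
noncomputable def etaCoeff (q : k) (β : Comp) : WithConv (QSym k →ₗ[k] k) :=
  toConv ((basisM k).coord β ∘ₗ etaLin q)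

/-- The functional sending `f` to the coefficient of `M_β` in `etaRevLin p q f`. -/
noncomputable def etaRevCoeff (p q : k) (β : Comp) : WithConv (QSym k →ₗ[k] k) :=
  toConv ((basisM k).coord β ∘ₗ etaRevLin p q)

theorem etaCoeff_apply (q : k) (β : Comp) (f : QSym k) :
    etaCoeff q β f = (basisM k).repr (etaLin q f) β := rfl

theorem etaRevCoeff_apply (p q : k) (β : Comp) (f : QSym k) :
    etaRevCoeff p q β f = (basisM k).repr (etaRevLin p q f) β := rfl

theorem conv_ext {f g : WithConv (QSym k →ₗ[k] k)} (h : ∀ α, f (M k α) = g (M k α)) : f = g := by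
  apply ofConv_injective
  refine (basisM k).ext fun α => ?_
  rw [basisM_apply]
  exact h α

theorem conv_sum_apply {ι : Type*} (s : Finset ι) (F : ι → WithConv (QSym k →ₗ[k] k))
    (f : QSym k) : (∑ u ∈ s, F u) f = ∑ u ∈ s, F u f := by
  classical
  induction s using Finset.induction_on with
  | empty => rfl
  | insert a s ha ih =>
    rw [Finset.sum_insert ha, Finset.sum_insert ha, ← ih]
    rfl

theorem etaCoeff_append (q : k) (β γ : Comp) :
    etaCoeff q (β ++ γ) = etaCoeff q β * etaCoeff q γ := by
  refine conv_ext fun α => ?_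
  rw [etaCoeff_apply, etaLin_M, repr_eta_append, etaCoeff, etaCoeff, convMul_apply_M]
  simp [etaLin_M]

theorem etaRevCoeff_append (p q : k) (β γ : Comp) :
    etaRevCoeff p q (β ++ γ) = etaRevCoeff p q γ * etaRevCoeff p q β := by
  refine conv_ext fun α => ?_
  rw [etaRevCoeff_apply, etaRevLin_M, map_smul, Finsupp.smul_apply, repr_eta_append, etaRevCoeff,
    etaRevCoeff, convMul_apply_M, List.length_reverse, smul_eq_mul, Finset.mul_sum,
    ← Finset.sum_range_reflect]
  refine Finset.sum_congr rfl fun i hi => ?_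
  have hi' : i ≤ α.length := Nat.lt_succ_iff.1 (Finset.mem_range.1 hi)
  have e : α.length + 1 - 1 - i = α.length - i := by omega
  have e' : α.length - (α.length - i) = i := by omega
  have e'' : (-q) ^ α.length = (-q) ^ i * (-q) ^ (α.length - i) := by
    rw [← pow_add]
    congr 1
    omega
  simp only [LinearMap.comp_apply, etaRevLin_M, Module.Basis.coord_apply, map_smul,
    smul_eq_mul, List.length_take, List.length_drop, min_eq_left hi', e, List.take_reverse,
    List.drop_reverse, e', e'']
  ring

/-! ### The identity in one variable -/

/-- The telescoping sum which expresses that `(1 - A) / (1 + q A)` and `(1 + q A) / (1 - A)` are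
inverse to each other. -/
theorem sum_neg_pow_mul_eq_zero {p q : k} (hpq : p * q = 1) {n : ℕ} (hn : n ≠ 0) :
    ∑ i ∈ Finset.range (n + 1),
      (-q) ^ i * (if i = 0 then 1 else p + 1) * (if i = n then 1 else q + 1) = 0 := by
  obtain ⟨n, rfl⟩ := Nat.exists_eq_succ_of_ne_zero hn
  have key : ∀ m : ℕ, ∑ i ∈ Finset.range (m + 1),
      (-q) ^ i * (if i = 0 then 1 else p + 1) * (q + 1) = (-q) ^ m * (q + 1) := by
    intro m
    induction m with
    | zero => simp
    | succ m ih =>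
      rw [Finset.sum_range_succ, ih, if_neg m.succ_ne_zero, pow_succ]
      linear_combination (-((-q) ^ m * (q + 1))) * hpq
  rw [Finset.sum_range_succ, Finset.sum_congr rfl fun i hi => by
    rw [if_neg (c := i = n + 1) (Finset.mem_range.1 hi).ne], key, if_pos rfl,
    if_neg n.succ_ne_zero, pow_succ]
  linear_combination (-((-q) ^ n)) * hpq

theorem tupleWord_const_zero : tupleWord (fun _ : Fin 1 => 0) = [] :=
  coe_list_inj (by rw [tupleWord, word_mono Fin.val_strictMono]; simp)

theorem tupleWord_const_pos (c : ℕ+) : tupleWord (fun _ : Fin 1 => (c : ℕ)) = [c] :=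
  coe_list_inj (by rw [tupleWord, word_mono Fin.val_strictMono]; simp)

/-- The coefficients of `η_α^{(q)}` at the powers of one variable. -/
theorem repr_eta_tupleWord_const (q : k) (α : Comp) (a : ℕ) :
    (basisM k).repr (eta q α) (tupleWord fun _ : Fin 1 => a) =
      if Comp.size α = a then (if α = [] then 1 else q + 1) else 0 := by
  rcases Nat.eq_zero_or_pos a with rfl | ha
  · rw [tupleWord_const_zero, repr_eta_nil]
    simp only [Comp.size_eq_zero]
    split_ifs <;> rfl
  · obtain ⟨c, rfl⟩ : ∃ c : ℕ+, (c : ℕ) = a := ⟨⟨a, ha⟩, rfl⟩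
    rw [tupleWord_const_pos, repr_eta_singleton]
    split_ifs with h1 h2
    · rw [h2, Comp.size_eq_zero.2 rfl] at h1
      omega
    · rfl
    · rfl

theorem sum_splits_const (a : ℕ) {A : Type*} [AddCommMonoid A] (F : (Fin 1 → ℕ × ℕ) → A) :
    ∑ s ∈ splits (fun _ : Fin 1 => a), F s =
      ∑ u ∈ Finset.HasAntidiagonal.antidiagonal a, F fun _ => u := by
  refine Finset.sum_nbij' (fun s => s 0) (fun u _ => u) ?_ ?_ ?_ ?_ ?_
  · intro s hs
    exact Fintype.mem_piFinset.1 hs 0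
  · intro u hu
    exact Fintype.mem_piFinset.2 fun _ => hu
  · intro s _
    ext t <;> rw [Subsingleton.elim t 0]
  · intro u _
    rfl
  · intro s _
    congr 1
    ext t <;> rw [Subsingleton.elim t 0]

theorem sum_etaRevCoeff_mul_etaCoeff_eq_zero {p q : k} (hpq : p * q = 1) (c : ℕ+) :
    ∑ s ∈ splits (fun _ : Fin 1 => (c : ℕ)), etaRevCoeff p q (tupleWord fun t => (s t).1) *
      etaCoeff q (tupleWord fun t => (s t).2) = 0 := by
  rw [sum_splits_const]
  refine conv_ext fun δ => ?_
  have hval : ∀ u : ℕ × ℕ, (etaRevCoeff p q (tupleWord fun _ : Fin 1 => u.1) *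
      etaCoeff q (tupleWord fun _ : Fin 1 => u.2)) (M k δ) =
      ∑ i ∈ Finset.range (δ.length + 1),
        if u = (Comp.size (δ.take i), Comp.size (δ.drop i)) then
          (-q) ^ i * (if i = 0 then 1 else p + 1) * (if i = δ.length then 1 else q + 1)
        else 0 := by
    rintro ⟨a, b⟩
    rw [etaRevCoeff, etaCoeff, convMul_apply_M]
    refine Finset.sum_congr rfl fun i hi => ?_
    have hi' : i ≤ δ.length := Nat.lt_succ_iff.1 (Finset.mem_range.1 hi)
    have h1 : (δ.take i).reverse = [] ↔ i = 0 := by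
      rw [← List.length_eq_zero_iff, List.length_reverse, List.length_take]
      omega
    have h2 : δ.drop i = [] ↔ i = δ.length := by
      rw [← List.length_eq_zero_iff, List.length_drop]
      omega
    have h3 : Comp.size (δ.take i).reverse = Comp.size (δ.take i) := by
      rw [Comp.size, List.map_reverse, List.sum_reverse, Comp.size]
    simp only [LinearMap.comp_apply, etaRevLin_M, etaLin_M, Module.Basis.coord_apply, map_smul,
      smul_eq_mul, repr_eta_tupleWord_const, List.length_take,
      min_eq_left hi', h1, h2, h3, Prod.mk.injEq, eq_comm (a := a), eq_comm (a := b)]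
    by_cases ha : Comp.size (δ.take i) = a <;> by_cases hb : Comp.size (δ.drop i) = b <;>
      simp [ha, hb]
  rw [conv_sum_apply, Finset.sum_congr rfl fun u _ => hval u, Finset.sum_comm]
  have hsize : ∀ i, Comp.size (δ.take i) + Comp.size (δ.drop i) = Comp.size δ := fun i => by
    rw [← Comp.size_append, List.take_append_drop]
  simp only [Finset.sum_ite_eq', Finset.HasAntidiagonal.mem_antidiagonal, hsize]
  change _ = (0 : k)
  by_cases hδ : Comp.size δ = c
  · simp only [if_pos hδ]
    refine sum_neg_pow_mul_eq_zero hpq fun h => ?_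
    rw [Comp.size_eq_zero.2 (List.length_eq_zero_iff.1 h)] at hδ
    exact c.pos.ne hδ
  · simp only [if_neg hδ, Finset.sum_const_zero]

/-! ### The convolution inverse -/

/-- A coefficient of a convolution product, as a sum over all ways to split the exponents. -/
theorem coord_convMul_tupleWord (f g : QSym k →ₗ[k] QSym k) {n : ℕ} (a : Fin n → ℕ) :
    toConv ((basisM k).coord (tupleWord a) ∘ₗ ofConv (toConv f * toConv g)) =
      ∑ s ∈ splits a, toConv ((basisM k).coord (tupleWord fun t => (s t).1) ∘ₗ f) *
        toConv ((basisM k).coord (tupleWord fun t => (s t).2) ∘ₗ g) := by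
  refine conv_ext fun α => ?_
  rw [conv_sum_apply]
  simp only [convMul_apply_M]
  change (basisM k).repr ((toConv f * toConv g) (M k α)) (tupleWord a) = _
  rw [convMul_apply_M, map_sum, Finsupp.finsetSum_apply, Finset.sum_comm]
  exact Finset.sum_congr rfl fun i _ => repr_mul _ _ a

theorem etaRevLin_convMul_etaLin {p q : k} (hpq : p * q = 1) :
    toConv (etaRevLin p q) * toConv (etaLin q) = 1 := by
  apply ofConv_injective
  refine (basisM k).ext fun α => (basisM k).ext_elem fun β => ?_
  rw [basisM_apply]
  change (basisM k).repr ((toConv (etaRevLin p q) * toConv (etaLin q)) (M k α)) β =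
    (basisM k).repr (algebraMap k (QSym k) (Coalgebra.counit (R := k) (M k α))) β
  rcases β with _ | ⟨c, β⟩
  · rw [← counit_eq_repr, ← counit_eq_repr, Bialgebra.counit_algebraMap, convMul_apply_M, map_sum,
      counit_M]
    simp only [Bialgebra.counit_mul, etaRevLin_M, etaLin_M, map_smul, counit_eq_repr,
      repr_eta_nil]
    by_cases hα : α = []
    · subst hα
      simp
    · rw [if_neg hα]
      refine Finset.sum_eq_zero fun i _ => ?_
      by_cases h : (α.take i).reverse = []
      · rw [if_neg (c := α.drop i = []), mul_zero]
        intro h'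
        apply hα
        rw [← List.take_append_drop i α, List.reverse_eq_nil_iff.1 h, h', List.append_nil]
      · rw [if_neg h, smul_zero, zero_mul]
  · have h := LinearMap.congr_fun (congrArg ofConv (coord_convMul_tupleWord (etaRevLin p q)
      (etaLin q) (Fin.append (fun _ : Fin 1 => (c : ℕ)) fun t => (β.get t : ℕ)))) (M k α)
    -- By the reversal, the contributions of the first entry `c` come last in the left factor and
    -- first in the right one; so they are adjacent, and their sum is `0`.
    have h0 : ∑ s ∈ splits (Fin.append (fun _ : Fin 1 => (c : ℕ)) fun t => (β.get t : ℕ)),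
        (etaRevCoeff p q (tupleWord fun t => (s t).1) *
          etaCoeff q (tupleWord fun t => (s t).2)) (M k α) = 0 := by
      rw [sum_splits_append, Finset.sum_comm]
      refine Finset.sum_eq_zero fun v _ => ?_
      rw [← conv_sum_apply _ fun u => etaRevCoeff p q (tupleWord fun t => (Fin.append u v t).1) *
        etaCoeff q (tupleWord fun t => (Fin.append u v t).2)]
      refine (LinearMap.congr_fun (congrArg ofConv ?_) (M k α)).trans
        (rfl : (0 : WithConv (QSym k →ₗ[k] k)) (M k α) = 0)
      rw [← zero_mul (etaCoeff q (tupleWord fun t => (v t).2)),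
        ← mul_zero (etaRevCoeff p q (tupleWord fun t => (v t).1)),
        ← sum_etaRevCoeff_mul_etaCoeff_eq_zero hpq c, Finset.mul_sum, Finset.sum_mul]
      refine Finset.sum_congr rfl fun u _ => ?_
      rw [comp_append u v Prod.fst, comp_append u v Prod.snd, tupleWord_append, tupleWord_append,
        etaRevCoeff_append, etaCoeff_append]
      simp only [mul_assoc]
    rw [tupleWord_append, tupleWord_const_pos, tupleWord_get] at h
    refine (h.trans ((conv_sum_apply _ _ _).trans h0)).trans ?_
    rw [Algebra.algebraMap_eq_smul_one, ← M_nil, map_smul, Finsupp.smul_apply, repr_M,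
      if_neg (List.cons_ne_nil c β).symm, smul_zero]

end QSymFn

theorem mainTheorem5 {k : Type*} [CommRing k] (p q : k) (hpq : p * q = 1) (α : QSymFn.Comp) :
    HopfAlgebra.antipode k (QSymFn.eta q α) =
      (-q) ^ α.length • QSymFn.eta p α.reverse := by
  have h := left_inv_eq_right_inv (QSymFn.etaRevLin_convMul_etaLin hpq)
    (QSymFn.etaLin_convMul_antipode_comp q)
  have h' := LinearMap.congr_fun (congrArg WithConv.ofConv h) (QSymFn.M k α)
  rw [← QSymFn.etaRevLin_M, ← QSymFn.etaLin_M]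
  exact h'.symm
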